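/- **Setting.** Let $\Pi$ be a synchronous interactive protocol of at most $n$ rounds between Alice and $m\ge 1$ Bobs; in each round one bit is transmitted between Alice and each Bob, in the direction determined by their internal states (after round $n$ Alice sends imaginary zeroes). It is simulated by a protocol $\Pi'$ over $m$ binary channels, in each of which a set of rounds fixed in advance is corrupted (the bit is flipped). Let $0<\epsilon<1$ (error rate) and $0<\delta<1$ (failure probability). The parameters of $\Pi'$ are positive integers $$c=\Theta(\log (m+1)),\quad o=\Theta(\log\tfrac1\delta),\quad r=\Theta\Big(\sqrt{\tfrac{c}{m^5\epsilon}}\Big),\quad R=\lceil \tfrac nr\rceil+\Theta(m^5n\epsilon),\quad I=\Theta(\log (o+1)).$$ **The simulation (Algorithms 1 and 2, for a Bob and for Alice).** For a message of $\ell$ bits, $\mathrm{RobustSend}(\cdot,t)$ sends a Justesen codeword of $\Theta(\ell+t)$ bits with minimum distance at least $2t+1$ if $t<\ell$, and otherwise repeats $2\lceil t/\ell\rceil+1$ times a Justesen codeword of $\Theta(\ell)$ bits with minimum distance at least $2\ell+1$ (the receiver decodes and takes a majority vote). A $\rho$-biased $q$-bit string is generated from a seed of $\Theta(\log\frac1\rho\log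 q)$ random bits. First, Alice sends to each Bob a random seed of a $2^{-o}$-biased string of $\Theta(Rro)$ bits with $\mathrm{RobustSend}(\cdot,\lceil 2n\epsilon\rceil)$. Then there are $\lceil R/I\rceil$ phases. In each phase Alice sends to each Bob a random seed of a $2^{-c}$-biased string of $cL$ bits, $L=\log R+o+O(1)$, with $\mathrm{RobustSend}(\cdot,I)$, and then $I$ epochs are run. Each epoch has three stages. 1. *Verification.* On each channel, each Bob sends four short hashes to Alice and then Alice sends four to him; a short hash is an inner-product hash in $\{0,1\}^c$ or the symbol $\bot$, transmitted with $c+1$ bits. The hashed objects are a counter $k$, and two candidate meeting points and the current epoch index $P$, each of these three together with an $o$-bit inner-product hash of the corresponding prefix of the simulated transcript. 2. *Computation.* $r$ rounds, in which a party simulates the next $r$ rounds of $\Pi$ if $k=1$ and its checks found no inconsistency (for Alice: on any channel), and otherwise performs a dummy simulation. 3. *Transition.* Without communication: a party resets its counters, or rolls back to a saved meeting point that received at least $0.4k$ votes when $k$ is a power of two, and discards all saved meeting points other than $P$ and those of the form $2^j\lfloor P/2^j\rfloor-2^j$. The *communication overhead* on a channel is $n'/n$, where $n'$ is the number of rounds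 in which a bit is transmitted over this channel in $\Pi'$. **Lemma (Simulation Overhead).** Fix the hidden constants of all the $\Theta$'s above, and constants $D,K>0$. There are constants $C,K_0>0$ such that the following hold. * If $m\le \min\{n^{0.25},(K/\epsilon)^{0.199}\}$ and $\exp(-D\,n^{0.249}\epsilon)\le\delta\le\frac1n$, then for every $\Pi$, all corruption patterns and all outcomes of the random seeds, the communication overhead of the simulation on each channel is at most $$1+C\,m^{2.5}\sqrt{\log(m+1)}\cdot\sqrt\epsilon .$$ * If $m\le (K_0/\epsilon)^{0.199}$, then this bound is at most $2$. -/

import Mathlib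

/-! Robust simulation of a leader/members ("Alice" and `m` "Bobs") interactive protocol over
noisy binary channels: protocols, channels, the pre-shared randomness, the two hash functions,
and the two simulation algorithms, executed jointly over the `m` channels. -/

namespace RobustSim

/-- Bits; addition is exclusive or. -/
abbrev Bit : Type := ZMod 2

/-! ### The original protocol -/

/-- A synchronous protocol between Alice and `m` Bobs. In every round each endpoint of each channel
either speaks (`some b`) or listens (`none`), as determined by its internal state; afterwards
the internal state is updated with the bit seen on the channel (sent or received).
Inputs and private coins are part of the initial states. -/
structure PreProtocol (m : ℕ) where
  AState : Type
  BState : Fin m → Type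
  aInit : AState
  bInit : ∀ i, BState i
  aOut : AState → Fin m → Option Bit
  bOut : ∀ i, BState i → Option Bit
  aNext : AState → (Fin m → Bit) → AState
  bNext : ∀ i, BState i → Bit → BState i

/-- The internal states of all parties at the end of round `t` of the noiseless execution. -/
def PreProtocol.run {m : ℕ} (Q : PreProtocol m) : ℕ → Q.AState × (∀ i, Q.BState i)
  | 0 => (Q.aInit, Q.bInit)
  | t + 1 =>
    let s := Q.run t
    let bit : Fin m → Bit := fun i => (Q.aOut s.1 i).getD ((Q.bOut i (s.2 i)).getD 0)
    (Q.aNext s.1 bit, fun i => Q.bNext i (s.2 i) (bit i))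

/-- A protocol of at most `n` rounds: in the noiseless execution exactly one endpoint of each channel
speaks in each round, and after round `n` Alice sends imaginary zeroes forever. -/
structure Protocol (m n : ℕ) extends PreProtocol m where
  oriented : ∀ t i, ((aOut (toPreProtocol.run t).1 i).isSome ↔
    bOut i ((toPreProtocol.run t).2 i) = none)
  padded : ∀ t, n ≤ t → ∀ i, aOut (toPreProtocol.run t).1 i = some 0

/-! ### Noisy channels -/

/-- The record of one channel: for every round so far, what Alice and what the Bob put on the
channel (`none` when listening). Its length is the number of rounds in which the channel was used. -/
abbrev Wire : Type := List (Option Bit × Option Bit)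

/-- The bits received when `msg` is sent over a channel that has been used for `pos` rounds;
round number `j` (counted from 0) is corrupted iff `noise j = 1`. The corruption pattern is fixed
in advance, so the channel is oblivious. -/
def corrupt (noise : ℕ → Bit) (pos : ℕ) (msg : List Bit) : List Bit :=
  msg.mapIdx fun j x => x + noise (pos + j)

/-- The wire after Alice has sent `msg`, one bit per round. -/
def Wire.aliceSends (w : Wire) (msg : List Bit) : Wire := w ++ msg.map fun x => (some x, none)

/-- The wire after the Bob has sent `msg`, one bit per round. -/
def Wire.bobSends (w : Wire) (msg : List Bit) : Wire := w ++ msg.map fun x => (none, some x)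

/-! ### Binary fields -/

/-- The field with `2 ^ (s + 1)` elements. -/
abbrev GF (s : ℕ) : Type := GaloisField 2 (s + 1)

/-- A fixed representation of field elements by `s + 1` bits. -/
noncomputable def gfBits (s : ℕ) : GF s ≃ₗ[ZMod 2] (Fin (s + 1) → Bit) :=
  (Module.finBasisOfFinrankEq (ZMod 2) (GF s) (GaloisField.finrank 2 s.succ_ne_zero)).equivFun

/-- The field element whose bits are the binary digits of `x`. -/
noncomputable def gfOfNat (s x : ℕ) : GF s :=
  (gfBits s).symm fun j => if x.testBit j then 1 else 0

/-- The bijection `rank` from the field onto `{1, …, 2 ^ (s + 1)}`. -/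
noncomputable def gfRank (s : ℕ) (v : GF s) : ℕ :=
  1 + ∑ j : Fin (s + 1), (gfBits s v j).val * 2 ^ (j : ℕ)

/-! ### Robust transmission -/

/-- The Justesen code used for messages of `l` bits and `t` errors is built over the field with
`2 ^ k` elements, where `k = justesenExp l t + 1` is least with `4 l ≤ k 2 ^ k` (so that the message
fits into `⌈2 ^ k / 4⌉` field elements) and `32 (2 t + 1) ≤ k 2 ^ k`
(the minimum distance is at least `k 2 ^ k / 32`). -/
noncomputable def justesenExp (l t : ℕ) : ℕ :=
  sInf {s : ℕ | 4 * l ≤ (s + 1) * 2 ^ (s + 1) ∧ 32 * (2 * t + 1) ≤ (s + 1) * 2 ^ (s + 1)}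

/-- Justesen encoding. The message (padded with zeroes) gives the coefficients of a polynomial
`f` with `⌈2 ^ k / 4⌉` coefficients; the codeword lists, for each nonzero field element `α`,
the `2 k` bits of the pair `(f α, α * f α)`. -/
noncomputable def justesenEncode (l t : ℕ) (msg : Fin l → Bit) : List Bit :=
  let s := justesenExp l t
  let word := List.ofFn msg
  let coeff : ℕ → GF s := fun x => (gfBits s).symm fun j => word.getD (x * (s + 1) + j) 0
  (List.range (2 ^ (s + 1) - 1)).flatMap fun y =>
    let α := gfOfNat s (y + 1)
    let v := ∑ x ∈ Finset.range ((2 ^ (s + 1) + 3) / 4), coeff x * α ^ x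
    List.ofFn (gfBits s v) ++ List.ofFn (gfBits s (α * v))

/-- Minimum distance decoding. -/
noncomputable def justesenDecode (l t : ℕ) (w : List Bit) : Fin l → Bit :=
  (Finite.exists_min fun msg : Fin l → Bit =>
    (List.zip (justesenEncode l t msg) w).countP fun z => z.1 ≠ z.2).choose

/-- Number of repetitions when `t ≥ l`. -/
def robustIter (l t : ℕ) : ℕ := 2 * (t ⌈/⌉ l) + 1

/-- The bits sent by `RobustSend(msg, t)` for an `l`-bit message. -/
noncomputable def robustSend (l t : ℕ) (msg : Fin l → Bit) : List Bit :=
  if t < l then justesenEncode l t msg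
  else (List.replicate (robustIter l t) (justesenEncode l l msg)).flatten

/-- One step of the Boyer-Moore majority vote on (candidate, counter). -/
def majorityStep {l : ℕ} (st : (Fin l → Bit) × ℕ) (x : Fin l → Bit) : (Fin l → Bit) × ℕ :=
  if st.2 = 0 then (x, 1) else if x = st.1 then (st.1, st.2 + 1) else (st.1, st.2 - 1)

/-- `RobustReceive(l, t)`: the message obtained from the received bits `w`. -/
noncomputable def robustReceive (l t : ℕ) (w : List Bit) : Fin l → Bit :=
  if t < l then justesenDecode l t w
  else
    let len := (justesenEncode l l 0).length
    (((List.range (robustIter l t)).map fun x =>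
      justesenDecode l l ((w.drop (x * len)).take len)).foldl majorityStep (0, 0)).1

/-! ### Biased randomness -/

/-- `Nat.log 2 q + 1`: the generator of `q` bits works over the field with `2 ^ genExp q` elements. -/
def genExp (q : ℕ) : ℕ := Nat.log 2 q + 1

/-- Length of the seed of the generator of `q` bits with `l` summands. -/
def seedLen (l q : ℕ) : ℕ := l * (1 + 10 * genExp q)

/-- `RandInit(seed, q, ρ)` followed by `ExtractBit(x + 1)`, with `l = Θ(log (1 / ρ))` summands:
the seed holds `l` bits `a`, and for each `t < l` seven field elements `b`,
`genExp q` bits `c` and two field elements `d`. -/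
noncomputable def extractBit (l q : ℕ) (seed : Fin (seedLen l q) → Bit) (x : ℕ) : Bit :=
  let s := Nat.log 2 q
  let bit : ℕ → Bit := fun j => (List.ofFn seed).getD j 0
  let elt : ℕ → GF s := fun pos => (gfBits s).symm fun j => bit (pos + j)
  let v := gfOfNat s x
  ∑ t ∈ Finset.range l,
    let base := l + t * (10 * (s + 1))
    let u := ∑ j ∈ Finset.range 7, elt (base + j * (s + 1)) * v ^ j
    let z := ∑ j ∈ Finset.range 2, elt (base + (8 + j) * (s + 1)) * v ^ j
    let idx := max 1 (Nat.clog 2 (gfRank s z))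
    bit t * (if gfRank s u % 2 = 0 then 0 else bit (base + 7 * (s + 1) + (idx - 1)))

/-! ### Parameters -/

/-- Parameters of the simulation: number `m` of Bobs, number `n` of rounds of the original protocol,
error rate `ε`, length `c` of the short hash, length `o` of the long hash, rounds `r` per epoch,
number `T` of extra epochs, number `I` of epochs per phase, and the numbers of summands used by
the generators of the randomness for the long and for the short hash. -/
structure Params where
  m : ℕ
  n : ℕ
  ε : ℝ
  c : ℕ
  o : ℕ
  r : ℕ
  T : ℕ
  I : ℕ
  lLong : ℕ
  lShort : ℕ

/-- `k = Θ(x)` with hidden constants `a` and `b`. -/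
def IsTheta (a b x : ℝ) (k : ℕ) : Prop := a * x ≤ k ∧ k ≤ b * x

namespace Params

variable (p : Params)

/-- `R = ⌈n / r⌉ + Θ(m ^ 5 n ε)`. -/
noncomputable def R : ℕ := ⌈(p.n : ℝ) / p.r⌉₊ + p.T

noncomputable def phases : ℕ := ⌈(p.R : ℝ) / p.I⌉₊

/-- The number of epochs that are run: `R`, rounded up to whole phases. -/
noncomputable def epochs : ℕ := p.phases * p.I

/-- The number of bits used to write an epoch index or a counter. -/
noncomputable def idxLen : ℕ := Nat.size p.epochs

/-- Maximum size of an object to which the short hash is applied. -/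
noncomputable def L : ℕ := p.idxLen + p.o

/-- Number of random bits for the long hash. -/
noncomputable def qLong : ℕ := p.epochs * p.r * p.o

/-- Number of random bits for the short hash. -/
noncomputable def qShort : ℕ := p.c * p.L

noncomputable def longSeedLen : ℕ := seedLen p.lLong p.qLong

noncomputable def shortSeedLen : ℕ := seedLen p.lShort p.qShort

/-- Number of corruptions tolerated by the transmission of the seed for the long hash. -/
noncomputable def tLong : ℕ := ⌈2 * p.n * p.ε⌉₊

/-- The choice of the parameters as functions of `m`, `n`, `ε` and `δ`, where all hidden constants
lie between `a` and `b`. The arguments `m + 1` and `o + 1` of the logarithms only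
matter for `m = 1` and `o = 1`. -/
structure Admissible (a b δ : ℝ) : Prop where
  c_theta : IsTheta a b (Real.log (p.m + 1)) p.c
  o_theta : IsTheta a b (Real.log (1 / δ)) p.o
  r_theta : IsTheta a b (Real.sqrt (p.c / ((p.m : ℝ) ^ 5 * p.ε))) p.r
  T_theta : IsTheta a b ((p.m : ℝ) ^ 5 * p.n * p.ε) p.T
  I_theta : IsTheta a b (Real.log (p.o + 1)) p.I
  lLong_theta : IsTheta a b p.o p.lLong
  lShort_theta : IsTheta a b p.c p.lShort

end Params

/-! ### Hash functions -/

/-- Binary digits of `x`, as a string of length `len`. -/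
def natBits (len x : ℕ) : List Bit := List.ofFn fun j : Fin len => if x.testBit j then 1 else 0

/-- The long hash of a transcript extended by the `q + 1`-st epoch `σ`, from the long hash of the
first `q` epochs. -/
def longHash (o r : ℕ) (S : ℕ → Bit) (q : ℕ) (H : Fin o → Bit) (σ : List Bit) : Fin o → Bit :=
  fun i => H i + ∑ j : Fin r, σ.getD j 0 * S (q * (r * o) + i * r + j)

/-- The `c`-bit short hash of an object of at most `L` bits. -/
def shortHash (c L : ℕ) (S : ℕ → Bit) (obj : List Bit) : Fin c → Bit :=
  fun i => ∑ j : Fin obj.length, obj.get j * S (i * L + j)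

/-- The four short hashes exchanged in the verification stage; `none` stands for `⊥`. -/
structure HashMsg (c : ℕ) where
  gk : Option (Fin c → Bit)
  g1 : Option (Fin c → Bit)
  g2 : Option (Fin c → Bit)
  gP : Option (Fin c → Bit)

/-- `(⊥, ⊥, ⊥, ⊥)`. -/
def HashMsg.bot (c : ℕ) : HashMsg c := ⟨none, none, none, none⟩

/-- A short hash or `⊥` is transmitted as one flag bit followed by `c` bits. -/
def hashWord (c : ℕ) : Option (Fin c → Bit) → List Bit
  | none => List.replicate (c + 1) 0
  | some h => 1 :: List.ofFn h

def HashMsg.toWord {c : ℕ} (g : HashMsg c) : List Bit :=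
  hashWord c g.gk ++ hashWord c g.g1 ++ hashWord c g.g2 ++ hashWord c g.gP

/-- The `j`-th hash in a received word. -/
def parseHash (c : ℕ) (w : List Bit) (j : ℕ) : Option (Fin c → Bit) :=
  if w.getD (j * (c + 1)) 0 = 1 then some fun x => w.getD (j * (c + 1) + 1 + x) 0 else none

def HashMsg.ofWord (c : ℕ) (w : List Bit) : HashMsg c :=
  ⟨parseHash c w 0, parseHash c w 1, parseHash c w 2, parseHash c w 3⟩

/-! ### The state of a party in the simulation -/

/-- State of a party whose channels are indexed by `ι` (one channel for a Bob, `m` for Alice)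
and whose internal states in the original protocol form the type `St`. -/
structure Party (ι St : Type) (o : ℕ) where
  P : ℕ
  k : ℕ
  E : ℕ
  v1 : ℕ
  v2 : ℕ
  /-- hash dictionary: long hashes (one for each channel) and internal state, for saved indices -/
  HD : ℕ → Option ((ι → Fin o → Bit) × St)
  /-- the pair of a round number and an internal state of the original protocol -/
  round : ℕ
  cur : St
  /-- the imaginary state tape -/
  tape : ℕ → Option St
  /-- the transcript of the epoch that is being simulated, for each channel -/
  sigma : ι → List Bit
  /-- randomness for the long hash -/
  SLong : ℕ → Bit
  /-- randomness for the short hash -/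
  SShort : ℕ → Bit

namespace Party

variable {ι St : Type} {o : ℕ}

/-- Initial state. The empty transcript prefix (index `0`, hash `0`) is always an available
meeting point. -/
def init (ξ : St) (SLong : ℕ → Bit) : Party ι St o where
  P := 0
  k := 0
  E := 0
  v1 := 0
  v2 := 0
  HD := fun q => if q = 0 then some (0, ξ) else none
  round := 0
  cur := ξ
  tape := fun _ => none
  sigma := fun _ => []
  SLong := SLong
  SShort := fun _ => 0

def resetCounters (st : Party ι St o) : Party ι St o := { st with k := 0, E := 0, v1 := 0, v2 := 0 }

/-- The counter `k`, rounded up to a power of two. -/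
def kk (st : Party ι St o) : ℕ := 2 ^ Nat.clog 2 st.k

def MP1 (st : Party ι St o) : ℕ := st.kk * (st.P / st.kk)

/-- The second meeting point; `none` if it is negative. -/
def MP2 (st : Party ι St o) : Option ℕ := if st.kk ≤ st.MP1 then some (st.MP1 - st.kk) else none

/-- Short hash of `(q, HD[q])` for the channel `ch`; it is `⊥` if `q` is not saved. -/
noncomputable def hashPoint (p : Params) (st : Party ι St p.o) (ch : ι) (q : ℕ) :
    Option (Fin p.c → Bit) :=
  (st.HD q).map fun e =>
    shortHash p.c p.L st.SShort (natBits p.idxLen q ++ List.ofFn (e.1 ch))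

/-- The four short hashes of a party for the channel `ch`. -/
noncomputable def hashes (p : Params) (st : Party ι St p.o) (ch : ι) : HashMsg p.c where
  gk := some (shortHash p.c p.L st.SShort (natBits p.idxLen st.k))
  g1 := st.hashPoint p ch st.MP1
  g2 := st.MP2.bind (st.hashPoint p ch)
  gP := st.hashPoint p ch st.P

/-- Beginning of the simulation of the next epoch. -/
def beginEpoch (st : Party ι St o) : Party ι St o :=
  { st with P := st.P + 1, sigma := fun _ => [] }

/-- One simulated round: the party has seen the bits `view` and moves to the internal state `ξ`;
the state tape is (over)written. -/
def observe (st : Party ι St o) (ξ : St) (view : ι → Bit) : Party ι St o :=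
  { st with
    cur := ξ
    round := st.round + 1
    tape := Function.update st.tape (st.round + 1) (some ξ)
    sigma := fun ch => st.sigma ch ++ [view ch] }

/-- End of the simulation of epoch `P`: the hashes and the state are saved, the counters are reset. -/
def endEpoch (r : ℕ) (st : Party ι St o) : Party ι St o :=
  let old : ι → Fin o → Bit := ((st.HD (st.P - 1)).map Prod.fst).getD 0
  let H : ι → Fin o → Bit := fun ch => longHash o r st.SLong (st.P - 1) (old ch) (st.sigma ch)
  resetCounters { st with HD := Function.update st.HD st.P (some (H, st.cur)) }

/-- Rollback to the meeting point `q`, restoring the internal state. -/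
def rollback (r : ℕ) (st : Party ι St o) (q : ℕ) : Party ι St o :=
  { st with
    P := q
    round := q * r
    cur := ((st.HD q).map Prod.snd).getD st.cur }

open Classical in
/-- Removal of the saved indices `q ≠ P` that are not of the form `2 ^ j ⌊P / 2 ^ j⌋ - 2 ^ j`. -/
noncomputable def prune (st : Party ι St o) : Party ι St o :=
  { st with
    HD := fun q =>
      if q = st.P ∨ ∃ j : ℕ, q + 2 ^ j = 2 ^ j * (st.P / 2 ^ j) then st.HD q else none }

/-- The transition stage, common to all parties. -/
noncomputable def transition (r : ℕ) (st : Party ι St o) : Party ι St o :=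
  prune <|
    if st.k ≤ 2 * st.E then st.resetCounters
    else if st.k = st.kk ∧ (0.4 : ℝ) * st.kk ≤ st.v1 then (st.rollback r st.MP1).resetCounters
    else if st.k = st.kk ∧ (0.4 : ℝ) * st.kk ≤ st.v2 then
      (st.rollback r (st.MP2.getD st.P)).resetCounters
    else if st.k = st.kk then { st with v1 := 0, v2 := 0 }
    else st

/-- Verification by a Bob with own hashes `g`, after receiving the hashes `g'` from Alice;
the counter `k` has already been increased. -/
def bobVerify {c : ℕ} (st : Party ι St o) (g g' : HashMsg c) : Party ι St o :=
  if g.gk ≠ g'.gk then { st with E := st.E + 1 }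
  else if g.g1 = g'.g1 ∨ g.g1 = g'.g2 then { st with v1 := st.v1 + 1 }
  else if g.g2 ≠ none ∧ (g.g2 = g'.g1 ∨ g.g2 = g'.g2) then { st with v2 := st.v2 + 1 }
  else st

/-- Whether a Bob simulates an epoch of the original protocol in the computation stage. -/
def bobComputes {c : ℕ} (st : Party ι St o) (g g' : HashMsg c) : Bool :=
  decide (st.k = 1 ∧ st.E = 0 ∧ g.gP = g'.gP)

/-- Verification by Alice with own hashes `g i`, after receiving `g' i` from each Bob: her new state,
the hashes that she sends, and whether she simulates an epoch in the computation stage. -/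
def aliceVerify {m c : ℕ} (st : Party (Fin m) St o) (g g' : Fin m → HashMsg c) :
    Party (Fin m) St o × (Fin m → HashMsg c) × Bool :=
  if ∃ i, (g i).gk ≠ (g' i).gk then
    ({ st with E := st.E + 1 }, fun _ => HashMsg.bot c, false)
  else
    let gP : Fin m → Option (Fin c → Bit) := fun i =>
      if ∃ i', (g i').gP ≠ (g' i').gP then none else (g i).gP
    let go : Bool := decide (st.k = 1 ∧ st.E = 0 ∧ ∀ i, gP i = (g' i).gP)
    if ∀ i, (g i).g1 = (g' i).g1 ∨ (g i).g1 = (g' i).g2 then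
      ({ st with v1 := st.v1 + 1 }, fun i => ⟨(g i).gk, (g i).g1, (g i).g2, gP i⟩, go)
    else if ∀ i, (g i).g2 ≠ none ∧ ((g i).g2 = (g' i).g1 ∨ (g i).g2 = (g' i).g2) then
      ({ st with v2 := st.v2 + 1 }, fun i => ⟨(g i).gk, none, (g i).g2, gP i⟩, go)
    else
      (st, fun i => ⟨(g i).gk, none, none, gP i⟩, go)

end Party

/-! ### Joint execution of the algorithms -/

/-- The states of all parties and the records of all channels. -/
structure Config (p : Params) (Q : Protocol p.m p.n) where
  alice : Party (Fin p.m) Q.AState p.o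
  bob : ∀ i, Party Unit (Q.BState i) p.o
  wire : Fin p.m → Wire

namespace Config

variable {p : Params} {Q : Protocol p.m p.n}

/-- Initialization, including the robust transmission of the seed for the long hash. -/
noncomputable def start (Q : Protocol p.m p.n) (noise : Fin p.m → ℕ → Bit)
    (coreStar : Fin p.longSeedLen → Bit) : Config p Q :=
  let msg := robustSend p.longSeedLen p.tLong coreStar
  { alice := Party.init Q.aInit (extractBit p.lLong p.qLong coreStar)
    bob := fun i => Party.init (Q.bInit i)
      (extractBit p.lLong p.qLong
        (robustReceive p.longSeedLen p.tLong (corrupt (noise i) 0 msg)))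
    wire := fun _ => Wire.aliceSends [] msg }

/-- `RelaxedShareRand`: Alice sends the seed `core` for the short hashes of a phase to every Bob. -/
noncomputable def refresh (noise : Fin p.m → ℕ → Bit) (core : Fin p.shortSeedLen → Bit)
    (s : Config p Q) : Config p Q :=
  let msg := robustSend p.shortSeedLen p.I core
  { alice := { s.alice with SShort := extractBit p.lShort p.qShort core }
    bob := fun i => { s.bob i with
      SShort := extractBit p.lShort p.qShort
        (robustReceive p.shortSeedLen p.I (corrupt (noise i) (s.wire i).length msg)) }
    wire := fun i => (s.wire i).aliceSends msg }

/-- The verification stage, together with the decision of each party whether it simulates an epoch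
of the original protocol in the computation stage. -/
noncomputable def verify (noise : Fin p.m → ℕ → Bit) (s : Config p Q) :
    Config p Q × Bool × (Fin p.m → Bool) :=
  let alice := { s.alice with k := s.alice.k + 1 }
  let bob : ∀ i, Party Unit (Q.BState i) p.o := fun i => { s.bob i with k := (s.bob i).k + 1 }
  let gA : Fin p.m → HashMsg p.c := fun i => alice.hashes p i
  let gB : Fin p.m → HashMsg p.c := fun i => (bob i).hashes p ()
  let wire1 : Fin p.m → Wire := fun i => (s.wire i).bobSends (gB i).toWord
  let fromBob : Fin p.m → HashMsg p.c := fun i =>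
    HashMsg.ofWord p.c (corrupt (noise i) (s.wire i).length (gB i).toWord)
  let res := alice.aliceVerify gA fromBob
  let wire2 : Fin p.m → Wire := fun i => (wire1 i).aliceSends (res.2.1 i).toWord
  let fromAlice : Fin p.m → HashMsg p.c := fun i =>
    HashMsg.ofWord p.c (corrupt (noise i) (wire1 i).length (res.2.1 i).toWord)
  let bob2 : ∀ i, Party Unit (Q.BState i) p.o := fun i => (bob i).bobVerify (gB i) (fromAlice i)
  ({ alice := res.1, bob := bob2, wire := wire2 }, res.2.2,
    fun i => (bob2 i).bobComputes (gB i) (fromAlice i))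

/-- One round of the computation stage. A simulating party behaves as in the original protocol; in a
dummy epoch Alice sends zeroes and a Bob listens. A party sees its own bit when it speaks,
and otherwise the (possibly corrupted) bit of the other party, with default `0` if nobody speaks. -/
def step (noise : Fin p.m → ℕ → Bit) (aSim : Bool) (bSim : Fin p.m → Bool) (s : Config p Q) :
    Config p Q :=
  let aSym : Fin p.m → Option Bit := fun i => if aSim then Q.aOut s.alice.cur i else some 0
  let bSym : Fin p.m → Option Bit := fun i => if bSim i then Q.bOut i (s.bob i).cur else none
  let err : Fin p.m → Bit := fun i => noise i (s.wire i).length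
  let aView : Fin p.m → Bit := fun i => (aSym i).getD ((bSym i).getD 0 + err i)
  let bView : Fin p.m → Bit := fun i => (bSym i).getD ((aSym i).getD 0 + err i)
  { alice := if aSim then s.alice.observe (Q.aNext s.alice.cur aView) aView else s.alice
    bob := fun i =>
      if bSim i then (s.bob i).observe (Q.bNext i (s.bob i).cur (bView i)) fun _ => bView i
      else s.bob i
    wire := fun i => s.wire i ++ [(aSym i, bSym i)] }

/-- The computation stage: `r` rounds. -/
def compute (noise : Fin p.m → ℕ → Bit) (aSim : Bool) (bSim : Fin p.m → Bool) (s : Config p Q) :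
    Config p Q :=
  let s1 : Config p Q :=
    { s with
      alice := if aSim then s.alice.beginEpoch else s.alice
      bob := fun i => if bSim i then (s.bob i).beginEpoch else s.bob i }
  let s2 := (step noise aSim bSim)^[p.r] s1
  { s2 with
    alice := if aSim then s2.alice.endEpoch p.r else s2.alice
    bob := fun i => if bSim i then (s2.bob i).endEpoch p.r else s2.bob i }

/-- One epoch of the simulation: verification, computation, transition. -/
noncomputable def epoch (noise : Fin p.m → ℕ → Bit) (s : Config p Q) : Config p Q :=
  let v := s.verify noise
  let s2 := v.1.compute noise v.2.1 v.2.2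
  { s2 with
    alice := s2.alice.transition p.r
    bob := fun i => (s2.bob i).transition p.r }

/-- The configuration after `x` phases. -/
noncomputable def afterPhases (Q : Protocol p.m p.n) (noise : Fin p.m → ℕ → Bit)
    (coreStar : Fin p.longSeedLen → Bit) (core : ℕ → Fin p.shortSeedLen → Bit) : ℕ → Config p Q
  | 0 => start Q noise coreStar
  | x + 1 => (epoch noise)^[p.I] (refresh noise (core x) (afterPhases Q noise coreStar core x))

end Config

/-- The final configuration of the simulation of `Q` for the corruption patterns `noise`, where
`coreStar` and `core` are the outcomes of the random seeds sampled by Alice. -/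
noncomputable def simulate (p : Params) (Q : Protocol p.m p.n) (noise : Fin p.m → ℕ → Bit)
    (coreStar : Fin p.longSeedLen → Bit) (core : ℕ → Fin p.shortSeedLen → Bit) : Config p Q :=
  Config.afterPhases Q noise coreStar core p.phases

/-- The communication overhead `n' / n` on channel `i`, where `n'` is the number of rounds in which
a bit is transmitted over the channel in the simulation. -/
noncomputable def overhead (p : Params) (Q : Protocol p.m p.n) (noise : Fin p.m → ℕ → Bit)
    (coreStar : Fin p.longSeedLen → Bit) (core : ℕ → Fin p.shortSeedLen → Bit) (i : Fin p.m) : ℝ :=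
  (((simulate p Q noise coreStar core).wire i).length : ℝ) / p.n

end RobustSim

namespace RobustSim

/-! ### Lengths of transmissions -/

/-! Every message has a length fixed by the parameters alone, and every round adds one entry to each
wire, whoever simulates. Hence `overhead_eq` is an exact formula, independent of `Q`, noise and
seeds: one long seed, one short seed per phase, and `8 (c + 1) + r` rounds per epoch.

Write `w = m ^ 5 ε` and `rate = √(c w)`. The number of epochs is at most `n / r + extra` with `extra
= 1 + T + I = O(n w)`, so the computation stages take at most `n + extra * r` rounds, and everything
else is overhead. The choice `r ≈ √(c / w)` balances hashing against extra epochs: `c / r` and `w r`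
are both `O(rate)`. The upper bound on `m` in terms of `ε` gives `rate = O(1)`, so `w ≤ w c = rate ^
2 = O(rate)`.

The seeds cost no more. Since `δ ≤ 1 / n`, all sizes are polynomial in `n` with `log n = O(o)`; the
long seed has `O(o ^ 2)` bits, and its transmission costs `O(o ^ 2 + n ε + 1) = O(n w)` because the
lower bound on `δ` gives `o = O(n ^ 0.249 ε)`. A short seed costs `O(c I)`, that is, `O(c)` per
epoch, like the hashes. Finally `c = O(log (m + 1))` turns `n * rate` into the claimed bound. -/

@[simp] theorem length_hashWord (c : ℕ) (h : Option (Fin c → Bit)) :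
    (hashWord c h).length = c + 1 := by
  cases h <;> simp [hashWord]

@[simp] theorem HashMsg.length_toWord {c : ℕ} (g : HashMsg c) :
    g.toWord.length = 4 * (c + 1) := by
  simp [HashMsg.toWord]
  ring

@[simp] theorem Wire.length_aliceSends (w : Wire) (msg : List Bit) :
    (w.aliceSends msg).length = w.length + msg.length := by
  simp [Wire.aliceSends]

@[simp] theorem Wire.length_bobSends (w : Wire) (msg : List Bit) :
    (w.bobSends msg).length = w.length + msg.length := by
  simp [Wire.bobSends]

theorem length_justesenEncode (l t : ℕ) (msg : Fin l → Bit) :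
    (justesenEncode l t msg).length =
      (2 ^ (justesenExp l t + 1) - 1) * (2 * (justesenExp l t + 1)) := by
  simp only [justesenEncode, List.length_flatMap, List.length_append, List.length_ofFn,
    List.map_const', List.sum_replicate, List.length_range, smul_eq_mul, two_mul]

/-- By minimality of the exponent, the preceding one violates one of the two defining inequalities,
and passing to the next exponent multiplies the length by a bounded factor only. -/
theorem length_justesenEncode_le (l t : ℕ) (hl : 1 ≤ l) (msg : Fin l → Bit) :
    (justesenEncode l t msg).length ≤ 1000 * (l + t) := by
  rw [length_justesenEncode]
  set s := justesenExp l t with hs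
  -- At exponent `0` there is no predecessor; the codeword then has two bits, and `1 ≤ l` suffices.
  rcases Nat.eq_zero_or_pos s with h0 | hpos
  · rw [h0]; omega
  · obtain ⟨u, hu⟩ : ∃ u, s = u + 1 := ⟨s - 1, by omega⟩
    have hlt : u < justesenExp l t := by omega
    have hnot := Nat.notMem_of_lt_sInf hlt
    simp only [Set.mem_ofPred_eq, not_and_or, not_le] at hnot
    have hpow : (2 : ℕ) ^ (s + 1) = 2 * 2 ^ (u + 1) := by rw [hu, pow_succ]; ring
    have h1 : (2 ^ (s + 1) - 1) * (2 * (s + 1)) ≤ 8 * ((u + 1) * 2 ^ (u + 1)) := by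
      calc (2 ^ (s + 1) - 1) * (2 * (s + 1)) ≤ 2 ^ (s + 1) * (2 * (s + 1)) :=
            Nat.mul_le_mul_right _ (Nat.sub_le _ _)
        _ = 2 ^ (u + 1) * (4 * (u + 2)) := by rw [hpow, hu]; ring
        _ ≤ 2 ^ (u + 1) * (8 * (u + 1)) := Nat.mul_le_mul_left _ (by omega)
        _ = _ := by ring
    rcases hnot with h | h <;> omega

/-- This lets the zero message stand for every seed in the length formulas. -/
theorem length_robustSend_eq (l t : ℕ) (msg msg' : Fin l → Bit) :
    (robustSend l t msg).length = (robustSend l t msg').length := by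
  unfold robustSend
  split_ifs <;> simp [length_justesenEncode]

theorem length_robustSend_le (l t : ℕ) (hl : 1 ≤ l) (msg : Fin l → Bit) :
    (robustSend l t msg).length ≤ 10000 * (l + t) := by
  unfold robustSend
  split_ifs with h
  · exact (length_justesenEncode_le l t hl msg).trans (by omega)
  · have hlen := length_justesenEncode_le l l hl msg
    -- Rounding up costs less than `l` per ceiling, so the product is below `2 t + 3 l`, and `l ≤ t`
    -- in this branch.
    have hiter : robustIter l t * l ≤ 5 * t := by
      have : (t ⌈/⌉ l) * l < t + l := by
        rw [Nat.ceilDiv_eq_add_pred_div]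
        have := Nat.div_mul_le_self (t + l - 1) l
        omega
      unfold robustIter
      nlinarith
    simp only [List.length_flatten, List.map_replicate, List.sum_replicate, smul_eq_mul]
    calc robustIter l t * (justesenEncode l l msg).length
        ≤ robustIter l t * (1000 * (l + l)) := Nat.mul_le_mul_left _ hlen
      _ = 2000 * (robustIter l t * l) := by ring
      _ ≤ 10000 * (l + t) := by omega

/-! ### Length of a wire after the simulation -/

namespace Config

variable {p : Params} {Q : Protocol p.m p.n}

/-- A round is recorded even when a party is in a dummy epoch or nobody speaks, so the decisions to
simulate do not affect the count. -/
theorem length_wire_step_iterate (noise : Fin p.m → ℕ → Bit) (aSim : Bool)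
    (bSim : Fin p.m → Bool) (s : Config p Q) (i : Fin p.m) (x : ℕ) :
    (((step noise aSim bSim)^[x] s).wire i).length = (s.wire i).length + x := by
  induction x generalizing s with
  | zero => rfl
  | succ x ih =>
    rw [Function.iterate_succ_apply, ih]
    simp [step]
    ring

theorem length_wire_compute (noise : Fin p.m → ℕ → Bit) (aSim : Bool)
    (bSim : Fin p.m → Bool) (s : Config p Q) (i : Fin p.m) :
    ((compute noise aSim bSim s).wire i).length = (s.wire i).length + p.r :=
  length_wire_step_iterate noise aSim bSim _ i p.r

theorem length_wire_verify (noise : Fin p.m → ℕ → Bit) (s : Config p Q) (i : Fin p.m) :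
    ((verify noise s).1.wire i).length = (s.wire i).length + 8 * (p.c + 1) := by
  simp only [verify, Wire.length_aliceSends, Wire.length_bobSends, HashMsg.length_toWord]
  ring

theorem length_wire_epoch_iterate (noise : Fin p.m → ℕ → Bit) (s : Config p Q) (i : Fin p.m)
    (x : ℕ) : (((epoch noise)^[x] s).wire i).length =
      (s.wire i).length + x * (8 * (p.c + 1) + p.r) := by
  induction x generalizing s with
  | zero => simp
  | succ x ih =>
    rw [Function.iterate_succ_apply, ih]
    have : ((epoch noise s).wire i).length = (s.wire i).length + 8 * (p.c + 1) + p.r := by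
      rw [← length_wire_verify noise s i]
      exact length_wire_compute noise _ _ _ i
    rw [this]
    ring

theorem length_wire_afterPhases (noise : Fin p.m → ℕ → Bit)
    (coreStar : Fin p.longSeedLen → Bit) (core : ℕ → Fin p.shortSeedLen → Bit) (i : Fin p.m)
    (x : ℕ) : ((afterPhases Q noise coreStar core x).wire i).length =
      (robustSend p.longSeedLen p.tLong 0).length +
        x * ((robustSend p.shortSeedLen p.I 0).length + p.I * (8 * (p.c + 1) + p.r)) := by
  induction x with
  | zero =>
    simp [afterPhases, start, length_robustSend_eq _ _ coreStar 0]
  | succ x ih =>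
    rw [afterPhases, length_wire_epoch_iterate]
    simp only [refresh, Wire.length_aliceSends, ih, length_robustSend_eq _ _ (core x) 0]
    ring

end Config

theorem overhead_eq (p : Params) (Q : Protocol p.m p.n) (noise : Fin p.m → ℕ → Bit)
    (coreStar : Fin p.longSeedLen → Bit) (core : ℕ → Fin p.shortSeedLen → Bit) (i : Fin p.m) :
    overhead p Q noise coreStar core i =
      ((robustSend p.longSeedLen p.tLong 0).length +
        p.phases * (robustSend p.shortSeedLen p.I 0).length +
        p.epochs * (8 * (p.c + 1) + p.r)) / p.n := by
  rw [overhead, simulate, Config.length_wire_afterPhases]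
  congr 1
  rw [Params.epochs]
  push_cast
  ring


open Filter Asymptotics

/-! ### Asymptotics of the parameters -/

theorem pow_mul_log_le {m : ℕ} {ε K : ℝ} (hm : 1 ≤ m) (hε : 0 < ε) (hK : 0 < K)
    (h : (m : ℝ) ≤ (K / ε) ^ (0.199 : ℝ)) : (m : ℝ) ^ 5 * ε * Real.log (m + 1) ≤ 41 * K := by
  have hm1 : (1 : ℝ) ≤ m := by exact_mod_cast hm
  have hm0 : (0 : ℝ) < m := by linarith
  -- The exponent `5.025` lies just below `1 / 0.199`; its excess over `5` pays for the logarithm.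
  have h1 : (m : ℝ) ^ (5.025 : ℝ) ≤ K / ε := by
    calc (m : ℝ) ^ (5.025 : ℝ) ≤ (m : ℝ) ^ ((0.199 : ℝ)⁻¹) :=
          Real.rpow_le_rpow_of_exponent_le hm1 (by norm_num)
      _ ≤ ((K / ε) ^ (0.199 : ℝ)) ^ ((0.199 : ℝ)⁻¹) :=
          Real.rpow_le_rpow hm0.le h (by norm_num)
      _ = K / ε := Real.rpow_rpow_inv (by positivity) (by norm_num)
  -- Here `41 = 1 / 0.025 + 1`, the last summand covering `log 2`.
  have h2 : Real.log (m + 1) ≤ 41 * (m : ℝ) ^ (0.025 : ℝ) := by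
    have e1 : Real.log (m + 1) ≤ Real.log (2 * m) := Real.log_le_log (by positivity) (by linarith)
    rw [Real.log_mul (by norm_num) hm0.ne'] at e1
    have e2 : Real.log 2 ≤ 1 := by linarith [Real.log_two_lt_d9]
    have e3 := Real.log_le_rpow_div hm0.le (show (0 : ℝ) < 0.025 by norm_num)
    have e4 := Real.one_le_rpow hm1 (show (0 : ℝ) ≤ 0.025 by norm_num)
    have e5 : (m : ℝ) ^ (0.025 : ℝ) / 0.025 = 40 * (m : ℝ) ^ (0.025 : ℝ) := by ring
    linarith
  have h3 : (m : ℝ) ^ (5.025 : ℝ) = (m : ℝ) ^ 5 * (m : ℝ) ^ (0.025 : ℝ) := by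
    rw [← Real.rpow_natCast (m : ℝ) 5, ← Real.rpow_add hm0]
    norm_num
  rw [le_div_iff₀ hε, h3] at h1
  calc (m : ℝ) ^ 5 * ε * Real.log (m + 1) ≤ (m : ℝ) ^ 5 * ε * (41 * (m : ℝ) ^ (0.025 : ℝ)) := by
        gcongr
    _ = 41 * ((m : ℝ) ^ 5 * (m : ℝ) ^ (0.025 : ℝ) * ε) := by ring
    _ ≤ 41 * K := by linarith

theorem rpow_mul_sqrt_log_mul_sqrt (m : ℕ) {ε : ℝ} (hε : 0 < ε) :
    (m : ℝ) ^ (2.5 : ℝ) * Real.sqrt (Real.log (m + 1)) * Real.sqrt ε =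
      Real.sqrt ((m : ℝ) ^ 5 * ε * Real.log (m + 1)) := by
  have hlog : 0 ≤ Real.log ((m : ℝ) + 1) := Real.log_nonneg (by linarith [m.cast_nonneg (α := ℝ)])
  have h : (m : ℝ) ^ (2.5 : ℝ) = Real.sqrt ((m : ℝ) ^ 5) := by
    rw [Real.sqrt_eq_rpow, ← Real.rpow_natCast, ← Real.rpow_mul m.cast_nonneg]
    norm_num
  rw [h, Real.sqrt_mul (by positivity), Real.sqrt_mul (by positivity)]
  ring

/-- The assumptions of the lemma on the overhead of the simulation. -/
structure InRegime (a b D K : ℝ) (p : Params) (δ : ℝ) : Prop where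
  one_le_m : 1 ≤ p.m
  ε_pos : 0 < p.ε
  ε_lt_one : p.ε < 1
  m_le_rpow : (p.m : ℝ) ≤ (p.n : ℝ) ^ (0.25 : ℝ)
  m_le : (p.m : ℝ) ≤ (K / p.ε) ^ (0.199 : ℝ)
  exp_le : Real.exp (-(D * (p.n : ℝ) ^ (0.249 : ℝ) * p.ε)) ≤ δ
  δ_le : δ ≤ 1 / p.n
  δ_lt_one : δ < 1
  admissible : p.Admissible a b δ

/-- The filter along which the parameters of the simulation are compared up to constants. -/
def regime (a b D K : ℝ) : Filter (Params × ℝ) := 𝓟 {x | InRegime a b D K x.1 x.2}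

theorem IsTheta.one_le {a b x : ℝ} {k : ℕ} (h : IsTheta a b x k) (ha : 0 < a) (hx : 0 < x) :
    1 ≤ k := by
  have : (0 : ℝ) < k := lt_of_lt_of_le (mul_pos ha hx) h.1
  exact_mod_cast this

/-- The quantity `m ^ 5 ε`. -/
noncomputable def Params.w (p : Params) : ℝ := (p.m : ℝ) ^ 5 * p.ε

/-- The order of magnitude `√(c m ^ 5 ε)` of the additional relative overhead. -/
noncomputable def Params.rate (p : Params) : ℝ := Real.sqrt (p.c * p.w)

/-! ### Positivity of the parameters and bounds on `log (1 / δ)` -/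

namespace InRegime

variable {a b D K δ : ℝ} {p : Params}

theorem one_le_n (h : InRegime a b D K p δ) : 1 ≤ p.n := by
  by_contra hn
  have h0 : p.n = 0 := by omega
  have h1 := h.m_le_rpow
  rw [h0, Nat.cast_zero, Real.zero_rpow (by norm_num)] at h1
  have h2 : (1 : ℝ) ≤ p.m := by exact_mod_cast h.one_le_m
  linarith

theorem one_le_c (h : InRegime a b D K p δ) (ha : 0 < a) : 1 ≤ p.c := by
  have hm : (1 : ℝ) ≤ p.m := by exact_mod_cast h.one_le_m
  exact h.admissible.c_theta.one_le ha (Real.log_pos (by linarith))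

theorem δ_pos (h : InRegime a b D K p δ) : 0 < δ := (Real.exp_pos _).trans_le h.exp_le

theorem one_le_o (h : InRegime a b D K p δ) (ha : 0 < a) : 1 ≤ p.o :=
  h.admissible.o_theta.one_le ha
    (Real.log_pos (by rw [lt_div_iff₀ h.δ_pos]; linarith [h.δ_lt_one]))

theorem w_pos (h : InRegime a b D K p δ) : 0 < p.w := by
  have hm : (1 : ℝ) ≤ p.m := by exact_mod_cast h.one_le_m
  have := h.ε_pos
  unfold Params.w
  positivity

theorem ε_le_w (h : InRegime a b D K p δ) : p.ε ≤ p.w := by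
  have hm : (1 : ℝ) ≤ (p.m : ℝ) ^ 5 := one_le_pow₀ (by exact_mod_cast h.one_le_m)
  unfold Params.w
  nlinarith [h.ε_pos]

theorem one_le_r (h : InRegime a b D K p δ) (ha : 0 < a) : 1 ≤ p.r := by
  have hc : (1 : ℝ) ≤ p.c := by exact_mod_cast h.one_le_c ha
  exact h.admissible.r_theta.one_le ha
    (Real.sqrt_pos.mpr (div_pos (by linarith) h.w_pos))

theorem one_le_I (h : InRegime a b D K p δ) (ha : 0 < a) : 1 ≤ p.I := by
  have ho : (1 : ℝ) ≤ p.o := by exact_mod_cast h.one_le_o ha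
  exact h.admissible.I_theta.one_le ha (Real.log_pos (by linarith))

theorem one_le_lLong (h : InRegime a b D K p δ) (ha : 0 < a) : 1 ≤ p.lLong :=
  h.admissible.lLong_theta.one_le ha (by exact_mod_cast h.one_le_o ha)

theorem one_le_lShort (h : InRegime a b D K p δ) (ha : 0 < a) : 1 ≤ p.lShort :=
  h.admissible.lShort_theta.one_le ha (by exact_mod_cast h.one_le_c ha)

theorem log_inv_le (h : InRegime a b D K p δ) :
    Real.log (1 / δ) ≤ D * (p.n : ℝ) ^ (0.249 : ℝ) * p.ε := by
  rw [one_div, Real.log_inv]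
  linarith [(Real.le_log_iff_exp_le h.δ_pos).mpr h.exp_le]

theorem log_n_le (h : InRegime a b D K p δ) : Real.log p.n ≤ Real.log (1 / δ) := by
  have hn : (1 : ℝ) ≤ p.n := by exact_mod_cast h.one_le_n
  refine Real.log_le_log (by linarith) ?_
  rw [le_div_iff₀ h.δ_pos, mul_comm, ← le_div_iff₀ (by linarith)]
  exact h.δ_le

end InRegime

/-! ### Comparison of parameters up to constants -/

section

variable {a b D K : ℝ}

/-- Along a principal filter, `=O` means a single constant valid at every point of the set. Chains
of `=O` thus produce constants depending on `a`, `b`, `D`, `K` only. -/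
theorem isBigO_regime {f g : Params × ℝ → ℝ} (A : ℝ)
    (h : ∀ p δ, InRegime a b D K p δ → 0 ≤ f (p, δ) ∧ f (p, δ) ≤ A * g (p, δ)) :
    f =O[regime a b D K] g := by
  rw [regime, isBigO_principal]
  refine ⟨|A|, fun x hx => ?_⟩
  obtain ⟨h0, h1⟩ := h x.1 x.2 hx
  rw [Real.norm_of_nonneg h0, Real.norm_eq_abs, ← abs_mul]
  exact h1.trans (le_abs_self _)

/-- The constant is taken at least `1` so that it is positive and has nonnegative logarithm. -/
theorem exists_le_of_isBigO {f g : Params × ℝ → ℝ} (h : f =O[regime a b D K] g) :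
    ∃ A, 1 ≤ A ∧ ∀ p δ, InRegime a b D K p δ → 0 ≤ g (p, δ) → f (p, δ) ≤ A * g (p, δ) := by
  rw [regime, isBigO_principal] at h
  obtain ⟨A, hA⟩ := h
  refine ⟨max A 1, le_max_right _ _, fun p δ hp hg => ?_⟩
  have := hA (p, δ) hp
  rw [Real.norm_of_nonneg hg] at this
  exact (le_abs_self _).trans (this.trans (by gcongr; exact le_max_left _ _))

theorem w_mul_c_isBigO_one (hb : 0 < b) (hK : 0 < K) :
    (fun x => x.1.w * x.1.c) =O[regime a b D K] fun _ => (1 : ℝ) := by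
  refine isBigO_regime (b * (41 * K)) fun p δ h => ⟨?_, ?_⟩
  · have := h.w_pos
    positivity
  · have h1 := pow_mul_log_le h.one_le_m h.ε_pos hK h.m_le
    have h2 := h.admissible.c_theta.2
    calc p.w * p.c ≤ p.w * (b * Real.log (p.m + 1)) := by
          have := h.w_pos.le
          gcongr
      _ = b * ((p.m : ℝ) ^ 5 * p.ε * Real.log (p.m + 1)) := by rw [Params.w]; ring
      _ ≤ _ := by rw [mul_one]; gcongr

theorem rate_isBigO_one (hb : 0 < b) (hK : 0 < K) :
    (fun x => x.1.rate) =O[regime a b D K] fun _ => (1 : ℝ) := by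
  obtain ⟨A, hA1, hA⟩ := exists_le_of_isBigO (w_mul_c_isBigO_one (D := D) hb hK)
  refine isBigO_regime (Real.sqrt A) fun p δ h => ⟨Real.sqrt_nonneg _, ?_⟩
  rw [mul_one]
  refine Real.sqrt_le_sqrt ?_
  have := hA p δ h zero_le_one
  simp only [mul_one] at this
  linarith

theorem rate_sq {δ : ℝ} {p : Params} (h : InRegime a b D K p δ) : p.rate * p.rate = p.c * p.w :=
  Real.mul_self_sqrt (mul_nonneg p.c.cast_nonneg h.w_pos.le)

/-- The product is `rate ^ 2`, and one factor `rate` is bounded. -/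
theorem w_mul_c_isBigO_rate (hb : 0 < b) (hK : 0 < K) :
    (fun x => x.1.w * x.1.c) =O[regime a b D K] fun x => x.1.rate := by
  have h1 : (fun x => x.1.w * x.1.c) =O[regime a b D K] fun x => x.1.rate * x.1.rate :=
    isBigO_regime 1 fun p δ h => by
      dsimp only
      rw [rate_sq h, one_mul, mul_comm]
      exact ⟨mul_nonneg p.c.cast_nonneg h.w_pos.le, le_rfl⟩
  simpa using h1.trans ((isBigO_refl _ _).mul (rate_isBigO_one hb hK))

theorem rate_isBigO (hb : 0 < b) :
    (fun x => x.1.rate) =O[regime a b D K] fun x =>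
      (x.1.m : ℝ) ^ (2.5 : ℝ) * Real.sqrt (Real.log (x.1.m + 1)) * Real.sqrt x.1.ε := by
  refine isBigO_regime (Real.sqrt b) fun p δ h => ⟨Real.sqrt_nonneg _, ?_⟩
  dsimp only
  rw [rpow_mul_sqrt_log_mul_sqrt _ h.ε_pos, ← Real.sqrt_mul hb.le]
  refine Real.sqrt_le_sqrt ?_
  have h2 := h.admissible.c_theta.2
  have := h.w_pos.le
  calc p.c * p.w ≤ b * Real.log (p.m + 1) * p.w := by gcongr
    _ = _ := by rw [Params.w]; ring

theorem one_isBigO_c (ha : 0 < a) :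
    (fun _ => (1 : ℝ)) =O[regime a b D K] fun x => (x.1.c : ℝ) :=
  isBigO_regime 1 fun p δ h => ⟨zero_le_one, by simpa using h.one_le_c ha⟩

theorem one_isBigO_o (ha : 0 < a) :
    (fun _ => (1 : ℝ)) =O[regime a b D K] fun x => (x.1.o : ℝ) :=
  isBigO_regime 1 fun p δ h => ⟨zero_le_one, by simpa using h.one_le_o ha⟩

theorem one_isBigO_I (ha : 0 < a) :
    (fun _ => (1 : ℝ)) =O[regime a b D K] fun x => (x.1.I : ℝ) :=
  isBigO_regime 1 fun p δ h => ⟨zero_le_one, by simpa using h.one_le_I ha⟩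

/-- The lower bound on `r` is used, with `√(c / w) * rate = c`. -/
theorem c_div_r_isBigO (ha : 0 < a) :
    (fun x => (x.1.c : ℝ) / x.1.r) =O[regime a b D K] fun x => x.1.rate := by
  refine isBigO_regime (1 / a) fun p δ h => ⟨by positivity, ?_⟩
  have hr : (0 : ℝ) < p.r := by exact_mod_cast h.one_le_r ha
  have h1 : a * Real.sqrt (p.c / p.w) ≤ p.r := h.admissible.r_theta.1
  dsimp only
  rw [div_le_iff₀ hr]
  have h2 : Real.sqrt (p.c / p.w) * p.rate = p.c := by
    rw [Params.rate, ← Real.sqrt_mul (div_nonneg p.c.cast_nonneg h.w_pos.le)]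
    rw [show (p.c : ℝ) / p.w * (p.c * p.w) = p.c * p.c by have := h.w_pos.ne'; field_simp]
    exact Real.sqrt_mul_self p.c.cast_nonneg
  calc (p.c : ℝ) = 1 / a * p.rate * (a * Real.sqrt (p.c / p.w)) := by
        nth_rewrite 1 [← h2]; field_simp
    _ ≤ _ := by
        have : 0 ≤ p.rate := Real.sqrt_nonneg _
        gcongr

/-- The upper bound on `r` is used, with `w * √(c / w) = rate`. -/
theorem w_mul_r_isBigO :
    (fun x => x.1.w * x.1.r) =O[regime a b D K] fun x => x.1.rate := by
  refine isBigO_regime b fun p δ h => ⟨mul_nonneg h.w_pos.le p.r.cast_nonneg, ?_⟩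
  have h1 : (p.r : ℝ) ≤ b * Real.sqrt (p.c / p.w) := h.admissible.r_theta.2
  have h2 : p.w * Real.sqrt (p.c / p.w) = p.rate := by
    nth_rewrite 1 [← Real.sqrt_mul_self h.w_pos.le]
    rw [← Real.sqrt_mul (mul_self_nonneg _), Params.rate]
    congr 1
    have := h.w_pos.ne'
    field_simp
  calc p.w * p.r ≤ p.w * (b * Real.sqrt (p.c / p.w)) := by have := h.w_pos.le; gcongr
    _ = b * p.rate := by rw [← h2]; ring

theorem o_isBigO_rpow (hb : 0 < b) :
    (fun x => (x.1.o : ℝ)) =O[regime a b D K] fun x => (x.1.n : ℝ) ^ (0.249 : ℝ) * x.1.ε := by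
  refine isBigO_regime (b * D) fun p δ h => ⟨by positivity, ?_⟩
  calc (p.o : ℝ) ≤ b * Real.log (1 / δ) := h.admissible.o_theta.2
    _ ≤ b * (D * (p.n : ℝ) ^ (0.249 : ℝ) * p.ε) := by gcongr; exact h.log_inv_le
    _ = _ := by ring

/-- The exponent `0.249` is below `1 / 2`, so the square of the power of `n` is at most `n`, while
`ε ^ 2 ≤ ε ≤ w`. -/
theorem o_mul_o_isBigO (hb : 0 < b) :
    (fun x => (x.1.o : ℝ) * x.1.o) =O[regime a b D K] fun x => x.1.n * x.1.w := by
  refine ((o_isBigO_rpow hb).mul (o_isBigO_rpow hb)).trans (isBigO_regime 1 fun p δ h => ?_)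
  have hε := h.ε_pos
  have hn : (1 : ℝ) ≤ p.n := by exact_mod_cast h.one_le_n
  refine ⟨by positivity, ?_⟩
  have h1 : (p.n : ℝ) ^ (0.249 : ℝ) * (p.n : ℝ) ^ (0.249 : ℝ) ≤ p.n := by
    rw [← Real.rpow_add (by linarith)]
    nth_rewrite 2 [← Real.rpow_one (p.n : ℝ)]
    exact Real.rpow_le_rpow_of_exponent_le hn (by norm_num)
  calc (p.n : ℝ) ^ (0.249 : ℝ) * p.ε * ((p.n : ℝ) ^ (0.249 : ℝ) * p.ε)
      = (p.n : ℝ) ^ (0.249 : ℝ) * (p.n : ℝ) ^ (0.249 : ℝ) * (p.ε * p.ε) := by ring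
    _ ≤ p.n * (p.w * 1) := by
        have := h.w_pos.le
        have := h.ε_le_w
        have := h.ε_lt_one.le
        gcongr
    _ = _ := by ring

/-- Since `o` is at least `1`, it is dominated by its square. In particular `n w` is bounded below,
which absorbs additive constants later. -/
theorem o_isBigO (ha : 0 < a) (hb : 0 < b) :
    (fun x => (x.1.o : ℝ)) =O[regime a b D K] fun x => x.1.n * x.1.w := by
  simpa using ((one_isBigO_o ha).mul (isBigO_refl (fun x => (x.1.o : ℝ)) _)).trans
    (o_mul_o_isBigO hb)

theorem w_isBigO_one (ha : 0 < a) (hb : 0 < b) (hK : 0 < K) :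
    (fun x => x.1.w) =O[regime a b D K] fun _ => (1 : ℝ) := by
  simpa using ((isBigO_refl (fun x : Params × ℝ => x.1.w) _).mul (one_isBigO_c ha)).trans
    (w_mul_c_isBigO_one hb hK)

theorem n_mul_w_isBigO (ha : 0 < a) (hb : 0 < b) (hK : 0 < K) :
    (fun x => x.1.n * x.1.w) =O[regime a b D K] fun x => (x.1.n : ℝ) := by
  simpa using (isBigO_refl (fun x => (x.1.n : ℝ)) _).mul (w_isBigO_one ha hb hK)

theorem log_n_isBigO (ha : 0 < a) :
    (fun x => Real.log x.1.n) =O[regime a b D K] fun x => (x.1.o : ℝ) := by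
  refine isBigO_regime (1 / a) fun p δ h => ⟨Real.log_natCast_nonneg _, ?_⟩
  have h1 := h.admissible.o_theta.1
  have h2 := h.log_n_le
  dsimp only
  rw [one_div, ← div_eq_inv_mul, le_div_iff₀ ha]
  nlinarith

/-- The link is `m ≤ n`, which gives `log (m + 1) ≤ 1 + log n`. -/
theorem c_isBigO_o (ha : 0 < a) (hb : 0 < b) :
    (fun x => (x.1.c : ℝ)) =O[regime a b D K] fun x => (x.1.o : ℝ) := by
  have h1 : (fun x => (x.1.c : ℝ)) =O[regime a b D K] fun x => 1 + Real.log x.1.n := by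
    refine isBigO_regime b fun p δ h => ⟨by positivity, h.admissible.c_theta.2.trans ?_⟩
    have hn : (1 : ℝ) ≤ p.n := by exact_mod_cast h.one_le_n
    have hm : (p.m : ℝ) ≤ p.n := by
      refine h.m_le_rpow.trans ?_
      nth_rewrite 2 [← Real.rpow_one (p.n : ℝ)]
      exact Real.rpow_le_rpow_of_exponent_le hn (by norm_num)
    have : Real.log (p.m + 1) ≤ Real.log (2 * p.n) :=
      Real.log_le_log (by positivity) (by linarith)
    rw [Real.log_mul (by norm_num) (by linarith)] at this
    have := Real.log_two_lt_d9
    gcongr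
    linarith
  exact h1.trans ((one_isBigO_o ha).add (log_n_isBigO ha))

theorem log_o_isBigO_I (ha : 0 < a) :
    (fun x => Real.log x.1.o) =O[regime a b D K] fun x => (x.1.I : ℝ) := by
  refine isBigO_regime (1 / a) fun p δ h => ⟨Real.log_natCast_nonneg _, ?_⟩
  have h1 := h.admissible.I_theta.1
  have ho : (1 : ℝ) ≤ p.o := by exact_mod_cast h.one_le_o ha
  have h2 : Real.log p.o ≤ Real.log (p.o + 1) := Real.log_le_log (by linarith) (by linarith)
  dsimp only
  rw [one_div, ← div_eq_inv_mul, le_div_iff₀ ha]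
  nlinarith

theorem I_isBigO (ha : 0 < a) (hb : 0 < b) :
    (fun x => (x.1.I : ℝ)) =O[regime a b D K] fun x => x.1.n * x.1.w := by
  have h1 : (fun x => (x.1.I : ℝ)) =O[regime a b D K] fun x => (x.1.o : ℝ) := by
    refine isBigO_regime b fun p δ h => ⟨by positivity, h.admissible.I_theta.2.trans ?_⟩
    have := Real.log_le_sub_one_of_pos (show (0 : ℝ) < (p.o : ℝ) + 1 by positivity)
    gcongr
    linarith
  exact h1.trans (o_isBigO ha hb)

theorem T_isBigO :
    (fun x => (x.1.T : ℝ)) =O[regime a b D K] fun x => x.1.n * x.1.w :=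
  isBigO_regime b fun p δ h => ⟨by positivity, h.admissible.T_theta.2.trans
    (le_of_eq (by simp only [Params.w]; ring))⟩

/-- Polynomial growth of `f` in `g` is all that matters for the logarithm; a square suffices for
every application. -/
theorem natLog_isBigO {f g : Params × ℝ → ℕ} {l : Params × ℝ → ℝ}
    (hfg : (fun x => (f x : ℝ)) =O[regime a b D K] fun x => (g x : ℝ) * g x)
    (hg : ∀ p δ, InRegime a b D K p δ → 1 ≤ g (p, δ))
    (h1 : (fun _ => (1 : ℝ)) =O[regime a b D K] l)
    (hl : (fun x => Real.log (g x)) =O[regime a b D K] l) :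
    (fun x => (Nat.log 2 (f x) : ℝ)) =O[regime a b D K] l := by
  obtain ⟨A, hA1, hA⟩ := exists_le_of_isBigO hfg
  have hfun : (fun x => (Nat.log 2 (f x) : ℝ)) =O[regime a b D K]
      fun x => Real.log A * 1 + 2 * Real.log (g x) := by
    refine isBigO_regime (1 / Real.log 2) fun p δ h => ⟨by positivity, ?_⟩
    have hg1 : (1 : ℝ) ≤ g (p, δ) := by exact_mod_cast hg p δ h
    have hlogg := Real.log_nonneg hg1
    have hlogA := Real.log_nonneg hA1
    have hlog2 : 0 < Real.log 2 := Real.log_pos (by norm_num)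
    rcases Nat.eq_zero_or_pos (f (p, δ)) with h0 | hpos
    · simp only [h0, Nat.log_zero_right, Nat.cast_zero]
      positivity
    · have e1 : ((2 : ℝ) ^ Nat.log 2 (f (p, δ))) ≤ f (p, δ) := by
        exact_mod_cast Nat.pow_log_le_self 2 hpos.ne'
      have e2 := Real.log_le_log (by positivity) (e1.trans (hA p δ h (by positivity)))
      rw [Real.log_pow, Real.log_mul (by linarith) (by nlinarith),
        Real.log_mul (by linarith) (by linarith)] at e2
      rw [one_div, ← div_eq_inv_mul, le_div_iff₀ hlog2]
      linarith
  exact hfun.trans ((h1.const_mul_left _).add (hl.const_mul_left _))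

/-- A bound for the number of epochs beyond the first `n / r`. -/
def Params.extra (p : Params) : ℝ := 1 + p.T + p.I

theorem extra_isBigO (ha : 0 < a) (hb : 0 < b) :
    (fun x => x.1.extra) =O[regime a b D K] fun x => x.1.n * x.1.w :=
  (((one_isBigO_I ha).trans (I_isBigO ha hb)).add T_isBigO).add (I_isBigO ha hb)

/-- Rounding `n / r` up costs at most one epoch, and completing the last phase at most `I`. -/
theorem epochs_le {δ : ℝ} {p : Params} (ha : 0 < a) (h : InRegime a b D K p δ) :
    (p.epochs : ℝ) ≤ p.n / p.r + p.extra := by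
  have hI : (0 : ℝ) < p.I := by exact_mod_cast h.one_le_I ha
  have h1 : (p.phases : ℝ) ≤ p.R / p.I + 1 := (Nat.ceil_lt_add_one (by positivity)).le
  have h2 : (⌈(p.n : ℝ) / p.r⌉₊ : ℝ) ≤ p.n / p.r + 1 := (Nat.ceil_lt_add_one (by positivity)).le
  calc (p.epochs : ℝ) = p.phases * p.I := by rw [Params.epochs, Nat.cast_mul]
    _ ≤ (p.R / p.I + 1) * p.I := by gcongr
    _ = p.R + p.I := by field_simp
    _ ≤ _ := by
        rw [Params.R, Params.extra]
        push_cast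
        linarith

/-- The main `n / r` epochs are controlled by `c / r = O(rate)`, the extra ones by `w c = O(rate)`.
-/
theorem epochs_mul_c_isBigO (ha : 0 < a) (hb : 0 < b) (hK : 0 < K) :
    (fun x => (x.1.epochs : ℝ) * x.1.c) =O[regime a b D K] fun x => x.1.n * x.1.rate := by
  have h1 : (fun x => (x.1.epochs : ℝ) * x.1.c) =O[regime a b D K]
      fun x => x.1.n * (x.1.c / x.1.r) + x.1.extra * x.1.c := by
    refine isBigO_regime 1 fun p δ h => ⟨by positivity, ?_⟩
    calc (p.epochs : ℝ) * p.c ≤ (p.n / p.r + p.extra) * p.c := by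
          gcongr
          exact epochs_le ha h
      _ = _ := by ring
  refine h1.trans (((isBigO_refl _ _).mul (c_div_r_isBigO ha)).add ?_)
  have h2 := (extra_isBigO (D := D) (K := K) ha hb).mul
    (isBigO_refl (fun x : Params × ℝ => (x.1.c : ℝ)) _)
  refine h2.trans ?_
  simp only [mul_assoc]
  exact (isBigO_refl _ _).mul (w_mul_c_isBigO_rate hb hK)

theorem extra_mul_r_isBigO (ha : 0 < a) (hb : 0 < b) :
    (fun x => x.1.extra * x.1.r) =O[regime a b D K] fun x => x.1.n * x.1.rate := by
  have h2 := (extra_isBigO (D := D) (K := K) ha hb).mul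
    (isBigO_refl (fun x : Params × ℝ => (x.1.r : ℝ)) _)
  refine h2.trans ?_
  simp only [mul_assoc]
  exact (isBigO_refl _ _).mul w_mul_r_isBigO

theorem epochs_mul_r_isBigO (ha : 0 < a) (hb : 0 < b) (hK : 0 < K) :
    (fun x => (x.1.epochs : ℝ) * x.1.r) =O[regime a b D K] fun x => (x.1.n : ℝ) := by
  have h1 : (fun x => (x.1.epochs : ℝ) * x.1.r) =O[regime a b D K]
      fun x => x.1.n + x.1.extra * x.1.r := by
    refine isBigO_regime 1 fun p δ h => ⟨by positivity, ?_⟩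
    have hr : (0 : ℝ) < p.r := by exact_mod_cast h.one_le_r ha
    calc (p.epochs : ℝ) * p.r ≤ (p.n / p.r + p.extra) * p.r := by
          gcongr
          exact epochs_le ha h
      _ = _ := by field_simp
  refine h1.trans ((isBigO_refl _ _).add ((extra_mul_r_isBigO ha hb).trans ?_))
  simpa using (isBigO_refl (fun x : Params × ℝ => (x.1.n : ℝ)) _).mul (rate_isBigO_one hb hK)

theorem size_le_log_add_one (x : ℕ) : Nat.size x ≤ Nat.log 2 x + 1 :=
  Nat.size_le.mpr (Nat.lt_pow_succ_log_self (by norm_num) x)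

theorem idxLen_isBigO (ha : 0 < a) (hb : 0 < b) (hK : 0 < K) :
    (fun x => (x.1.idxLen : ℝ)) =O[regime a b D K] fun x => (x.1.o : ℝ) := by
  have h1 : (fun x => (x.1.epochs : ℝ)) =O[regime a b D K] fun x => (x.1.n : ℝ) * x.1.n := by
    refine (isBigO_regime (g := fun x => (x.1.epochs : ℝ) * x.1.r) 1 fun p δ h =>
      ⟨by positivity, ?_⟩).trans ((epochs_mul_r_isBigO ha hb hK).trans
        (isBigO_regime 1 fun p δ h => ⟨by positivity, ?_⟩))
    · have hr : (1 : ℝ) ≤ p.r := by exact_mod_cast h.one_le_r ha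
      have : (0 : ℝ) ≤ p.epochs := by positivity
      dsimp only
      nlinarith
    · have hn : (1 : ℝ) ≤ p.n := by exact_mod_cast h.one_le_n
      dsimp only
      nlinarith
  have h2 := natLog_isBigO (f := fun x => x.1.epochs) (g := fun x => x.1.n) h1
    (fun p δ h => h.one_le_n) (one_isBigO_o ha) (log_n_isBigO ha)
  refine (isBigO_regime 1 fun p δ h => ⟨by positivity, ?_⟩).trans (h2.add (one_isBigO_o ha))
  rw [one_mul]
  exact_mod_cast size_le_log_add_one p.epochs

theorem genExp_qShort_isBigO (ha : 0 < a) (hb : 0 < b) (hK : 0 < K) :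
    (fun x => (genExp x.1.qShort : ℝ)) =O[regime a b D K] fun x => (x.1.I : ℝ) := by
  have h1 : (fun x => (x.1.qShort : ℝ)) =O[regime a b D K] fun x => (x.1.o : ℝ) * x.1.o := by
    simp only [Params.qShort, Params.L, Nat.cast_mul, Nat.cast_add]
    exact (c_isBigO_o ha hb).mul ((idxLen_isBigO ha hb hK).add (isBigO_refl _ _))
  have h2 := natLog_isBigO (f := fun x => x.1.qShort) (g := fun x => x.1.o) h1
    (fun p δ h => h.one_le_o ha) (one_isBigO_I ha) (log_o_isBigO_I ha)
  simpa [genExp] using h2.add (one_isBigO_I ha)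

theorem genExp_qLong_isBigO (ha : 0 < a) (hb : 0 < b) (hK : 0 < K) :
    (fun x => (genExp x.1.qLong : ℝ)) =O[regime a b D K] fun x => (x.1.o : ℝ) := by
  have h1 : (fun x => (x.1.qLong : ℝ)) =O[regime a b D K] fun x => (x.1.n : ℝ) * x.1.n := by
    simp only [Params.qLong, Nat.cast_mul]
    exact (epochs_mul_r_isBigO ha hb hK).mul
      ((o_isBigO ha hb).trans (n_mul_w_isBigO ha hb hK))
  have h2 := natLog_isBigO (f := fun x => x.1.qLong) (g := fun x => x.1.n) h1
    (fun p δ h => h.one_le_n) (one_isBigO_o ha) (log_n_isBigO ha)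
  simpa [genExp] using h2.add (one_isBigO_o ha)

/-! ### Cost of transmitting the seeds -/

theorem length_shortSeed_isBigO (ha : 0 < a) (hb : 0 < b) (hK : 0 < K) :
    (fun x => ((robustSend x.1.shortSeedLen x.1.I 0).length : ℝ)) =O[regime a b D K]
      fun x => x.1.c * (x.1.I : ℝ) := by
  have h1 : (fun x => (x.1.shortSeedLen : ℝ)) =O[regime a b D K]
      fun x => x.1.c * (x.1.I : ℝ) := by
    simp only [Params.shortSeedLen, seedLen, Nat.cast_mul, Nat.cast_add, Nat.cast_one,
      Nat.cast_ofNat]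
    exact IsBigO.mul (isBigO_regime b fun p δ h => ⟨by positivity, h.admissible.lShort_theta.2⟩)
      ((one_isBigO_I ha).add ((genExp_qShort_isBigO ha hb hK).const_mul_left _))
  have h2 : (fun x => (x.1.I : ℝ)) =O[regime a b D K] fun x => x.1.c * (x.1.I : ℝ) := by
    simpa using (one_isBigO_c ha).mul (isBigO_refl (fun x => (x.1.I : ℝ)) _)
  refine (isBigO_regime 10000 fun p δ h => ⟨by positivity, ?_⟩).trans (h1.add h2)
  exact_mod_cast length_robustSend_le _ _
    (Nat.mul_pos (h.one_le_lShort ha) (by positivity)) 0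

theorem length_longSeed_isBigO (ha : 0 < a) (hb : 0 < b) (hK : 0 < K) :
    (fun x => ((robustSend x.1.longSeedLen x.1.tLong 0).length : ℝ)) =O[regime a b D K]
      fun x => x.1.n * x.1.w := by
  have h1 : (fun x => (x.1.longSeedLen : ℝ)) =O[regime a b D K] fun x => x.1.n * x.1.w := by
    simp only [Params.longSeedLen, seedLen, Nat.cast_mul, Nat.cast_add, Nat.cast_one,
      Nat.cast_ofNat]
    exact (IsBigO.mul (isBigO_regime b fun p δ h => ⟨by positivity, h.admissible.lLong_theta.2⟩)
      ((one_isBigO_o ha).add ((genExp_qLong_isBigO ha hb hK).const_mul_left _))).trans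
      (o_mul_o_isBigO hb)
  have h2 : (fun x => (x.1.tLong : ℝ)) =O[regime a b D K] fun x => x.1.n * x.1.w := by
    have h3 : (fun x => 2 * x.1.n * x.1.ε) =O[regime a b D K] fun x => x.1.n * x.1.w := by
      refine isBigO_regime 2 fun p δ h => ⟨?_, ?_⟩
      · have := h.ε_pos
        positivity
      · have := h.ε_le_w
        dsimp only
        rw [mul_assoc]
        gcongr
    -- The `1` lost in the ceiling is absorbed through `1 = O(I) = O(n w)`.
    refine (isBigO_regime 1 fun p δ h => ⟨by positivity, ?_⟩).trans
      (h3.add ((one_isBigO_I ha).trans (I_isBigO ha hb)))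
    rw [one_mul]
    have := h.ε_pos
    exact (Nat.ceil_lt_add_one (by positivity)).le
  refine (isBigO_regime 10000 fun p δ h => ⟨by positivity, ?_⟩).trans (h1.add h2)
  exact_mod_cast length_robustSend_le _ _
    (Nat.mul_pos (h.one_le_lLong ha) (by positivity)) 0

/-- A seed of cost `O(c I)` is shared by the `I` epochs of its phase, so the total is of the order
of `epochs * c`. -/
theorem phases_mul_length_isBigO (ha : 0 < a) (hb : 0 < b) (hK : 0 < K) :
    (fun x => x.1.phases * ((robustSend x.1.shortSeedLen x.1.I 0).length : ℝ))
      =O[regime a b D K] fun x => x.1.n * x.1.rate := by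
  refine ((isBigO_refl _ _).mul (length_shortSeed_isBigO ha hb hK)).trans
    (IsBigO.trans (isBigO_regime 1 fun p δ h => ⟨by positivity, ?_⟩)
      (epochs_mul_c_isBigO ha hb hK))
  simp only [Params.epochs, Nat.cast_mul]
  exact le_of_eq (by ring)

/-- The number of bits on a channel exceeds `n` by `O(n √(c m ^ 5 ε))`. -/
theorem exists_length_le (ha : 0 < a) (hb : 0 < b) (hK : 0 < K) :
    ∃ A, 1 ≤ A ∧ ∀ p δ, InRegime a b D K p δ →
      ((robustSend p.longSeedLen p.tLong 0).length +
        p.phases * (robustSend p.shortSeedLen p.I 0).length +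
        p.epochs * (8 * (p.c + 1) + p.r) : ℝ) ≤
      p.n + A * (p.n * ((p.m : ℝ) ^ (2.5 : ℝ) * Real.sqrt (Real.log (p.m + 1)) *
        Real.sqrt p.ε)) := by
  have h1 : (fun x => x.1.n * x.1.w) =O[regime a b D K] fun x => x.1.n * x.1.rate := by
    refine (isBigO_refl _ _).mul (IsBigO.trans ?_ (w_mul_c_isBigO_rate hb hK))
    simpa using (isBigO_refl (fun x : Params × ℝ => x.1.w) _).mul (one_isBigO_c ha)
  have h2 := ((((length_longSeed_isBigO (D := D) ha hb hK).trans h1).add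
    (phases_mul_length_isBigO ha hb hK)).add
    ((epochs_mul_c_isBigO ha hb hK).const_mul_left 16)).add (extra_mul_r_isBigO ha hb)
  obtain ⟨A, hA1, hA⟩ := exists_le_of_isBigO
    (h2.trans ((isBigO_refl _ _).mul (rate_isBigO hb)))
  refine ⟨A, hA1, fun p δ h => ?_⟩
  have h3 := hA p δ h (by positivity)
  dsimp only at h3
  have hr : (0 : ℝ) < p.r := by exact_mod_cast h.one_le_r ha
  have hc : (1 : ℝ) ≤ p.c := by exact_mod_cast h.one_le_c ha
  -- This is the only source of the leading term, hence its coefficient is exactly `1`.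
  have h4 : (p.epochs : ℝ) * p.r ≤ p.n + p.extra * p.r := by
    calc (p.epochs : ℝ) * p.r ≤ (p.n / p.r + p.extra) * p.r := by
          gcongr
          exact epochs_le ha h
      _ = _ := by field_simp
  -- As `1 ≤ c`, one has `8 (c + 1) ≤ 16 c`; this is the factor `16` in `h2`.
  have h5 : (p.epochs : ℝ) * (8 * (p.c + 1)) ≤ 16 * (p.epochs * p.c) := by
    have : (0 : ℝ) ≤ p.epochs := by positivity
    nlinarith
  rw [mul_add]
  linarith

end

end RobustSim

theorem mainTheorem8 (a b D K : ℝ) (ha : 0 < a) (hb : 0 < b) (hD : 0 < D) (hK : 0 < K) :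
    ∃ C K₀ : ℝ, 0 < C ∧ 0 < K₀ ∧
      (∀ (p : RobustSim.Params) (δ : ℝ),
        1 ≤ p.m → 0 < p.ε → p.ε < 1 →
        (p.m : ℝ) ≤ (p.n : ℝ) ^ (0.25 : ℝ) →
        (p.m : ℝ) ≤ (K / p.ε) ^ (0.199 : ℝ) →
        Real.exp (-(D * (p.n : ℝ) ^ (0.249 : ℝ) * p.ε)) ≤ δ →
        δ ≤ 1 / p.n → δ < 1 →
        p.Admissible a b δ →
        ∀ (Q : RobustSim.Protocol p.m p.n) (noise : Fin p.m → ℕ → RobustSim.Bit)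
          (coreStar : Fin p.longSeedLen → RobustSim.Bit)
          (core : ℕ → Fin p.shortSeedLen → RobustSim.Bit) (i : Fin p.m),
          RobustSim.overhead p Q noise coreStar core i ≤
            1 + C * ((p.m : ℝ) ^ (2.5 : ℝ) * Real.sqrt (Real.log (p.m + 1))) * Real.sqrt p.ε) ∧
      (∀ (m : ℕ) (ε : ℝ), 1 ≤ m → 0 < ε → (m : ℝ) ≤ (K₀ / ε) ^ (0.199 : ℝ) →
        1 + C * ((m : ℝ) ^ (2.5 : ℝ) * Real.sqrt (Real.log (m + 1))) * Real.sqrt ε ≤ 2) := by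
  obtain ⟨C, hC1, hC⟩ := RobustSim.exists_length_le (D := D) ha hb hK
  have hC0 : 0 < C := by linarith
  -- With this `K₀`, the bound `41 * K₀` of `pow_mul_log_le` equals `1 / C ^ 2`, so `C` times its
  -- square root is `1`.
  refine ⟨C, 1 / (41 * C ^ 2), hC0, by positivity, ?_, ?_⟩
  · intro p δ hm hε hε1 hmn hmε hexp hδn hδ hadm Q noise coreStar core i
    have h : RobustSim.InRegime a b D K p δ := ⟨hm, hε, hε1, hmn, hmε, hexp, hδn, hδ, hadm⟩
    have hn : (0 : ℝ) < p.n := by exact_mod_cast h.one_le_n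
    rw [RobustSim.overhead_eq, div_le_iff₀ hn]
    refine (hC p δ h).trans (le_of_eq ?_)
    ring
  · intro m ε hm hε hmε
    have h := RobustSim.pow_mul_log_le hm hε (by positivity) hmε
    rw [mul_assoc C, RobustSim.rpow_mul_sqrt_log_mul_sqrt m hε]
    have h1 : Real.sqrt ((m : ℝ) ^ 5 * ε * Real.log (m + 1)) ≤ 1 / C := by
      rw [Real.sqrt_le_left (by positivity)]
      refine h.trans (le_of_eq ?_)
      field_simp
    have h2 : C * Real.sqrt ((m : ℝ) ^ 5 * ε * Real.log (m + 1)) ≤ C * (1 / C) := by gcongr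
    rw [mul_one_div_cancel hC0.ne'] at h2
    linarith
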